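/- Let $\omega=\{0,1,2,\dots\}\subset\mathbb C$ and let $F_\omega\subset\mathbb C^{\omega}$ be the space of injective maps $u:\omega\to\mathbb C$, with the subspace topology of the product topology. An $\omega$-braid is a path $f:[0,1]\to F_\omega$ with $f(0)=\mathrm{id}_\omega$ and with $f(1)$ a permutation of $\omega$. Let $B_\omega$ be the group of homotopy classes relative to $\{0,1\}$ of $\omega$-braids, with product $[f][g]=[f\cdot g^{f(1)}]$, where $\cdot$ is concatenation of paths and $g^{\sigma}(t)(x)=g(t)(\sigma(x))$. Theorem. Let $A=B_\omega/(B_\omega)'$ be the abelianization of $B_\omega$, written additively. Then: 1. $A$ is cotorsion, that is, $\operatorname{Ext}(J,A)=0$ for every torsion-free abelian group $J$; equivalently, every short exact sequence $0\to A\to E\to J\to 0$ of abelian groups with $J$ torsion-free splits. 2. $A$ is complete modulo its Ulm subgroup, that is, for every sequence $(x_n)_{n\ge 1}$ in $A$ such that $n!$ divides $x_{n+1}-x_n$ in $A$ for all $n\ge 1$, there exists $x\in A$ such that $n!$ divides $x-x_n$ in $A$ for all $n\ge 1$. -/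

import Mathlib

namespace InfBraid

/-- The space `F_X = ℂ^X ∖ Δ_X` of injective maps `X → ℂ`, as a subspace of the product `ℂ^X`. -/
abbrev ConfSpace (X : Set ℂ) : Type := {u : X → ℂ // Function.Injective u}

/-- A permutation of `X`, regarded as a point of `F_X`. -/
def permPoint {X : Set ℂ} (σ : Equiv.Perm X) : ConfSpace X :=
  ⟨fun x => (σ x : ℂ), fun _ _ h => σ.injective (Subtype.ext h)⟩

/-- The point `id_X` of `F_X`. -/
def basePoint (X : Set ℂ) : ConfSpace X := permPoint 1

/-- The action of a permutation on `F_X` by coordinate transformation, `u ↦ u ∘ σ`. -/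
def permAct {X : Set ℂ} (σ : Equiv.Perm X) : C(ConfSpace X, ConfSpace X) where
  toFun u := ⟨fun x => u.1 (σ x), fun _ _ h => σ.injective (u.2 h)⟩
  continuous_toFun := by
    refine Continuous.subtype_mk (continuous_pi fun x => ?_) _
    exact (continuous_apply (σ x)).comp continuous_subtype_val

theorem permAct_permPoint {X : Set ℂ} (σ τ : Equiv.Perm X) :
    permAct σ (permPoint τ) = permPoint (τ * σ) := rfl

theorem permAct_basePoint {X : Set ℂ} (σ : Equiv.Perm X) :
    permAct σ (basePoint X) = permPoint σ := rfl

/-- An `X`-braid: a path in `F_X` from `id_X` to a permutation of `X`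
(the permutation is determined by the path). -/
structure Braid (X : Set ℂ) where
  perm : Equiv.Perm X
  path : Path (basePoint X) (permPoint perm)

namespace Braid

variable {X : Set ℂ}

/-- Equivalence of `X`-braids: homotopy relative to `{0, 1}` of the underlying maps `I → F_X`. -/
def Equivalent (f g : Braid X) : Prop :=
  ContinuousMap.HomotopicRel f.path.toContinuousMap g.path.toContinuousMap {0, 1}

theorem permPoint_injective : Function.Injective (permPoint (X := X)) := by
  intro σ τ h
  ext x
  exact congrFun (congrArg Subtype.val h) x

theorem Equivalent.perm_eq {f g : Braid X} (h : Equivalent f g) : f.perm = g.perm := by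
  apply permPoint_injective
  obtain ⟨H⟩ := h
  have h1 : f.path 1 = g.path 1 := H.fst_eq_snd (by simp)
  simpa using h1

/-- Braids with the same permutation are equivalent when their paths are homotopic. -/
theorem equivalent_mk {σ : Equiv.Perm X} {p q : Path (basePoint X) (permPoint σ)} :
    Equivalent ⟨σ, p⟩ ⟨σ, q⟩ ↔ Path.Homotopic p q := Iff.rfl

instance setoid (X : Set ℂ) : Setoid (Braid X) where
  r := Equivalent
  iseqv := ⟨fun f => ContinuousMap.HomotopicRel.refl f.path.toContinuousMap,
    fun h => ContinuousMap.HomotopicRel.symm h, fun h k => ContinuousMap.HomotopicRel.trans h k⟩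

/-- The path `f^σ`, where `f^σ(t)(x) = f(t)(σ x)`. -/
noncomputable def actPath (σ : Equiv.Perm X) {a b : ConfSpace X} (p : Path a b) :
    Path (permAct σ a) (permAct σ b) :=
  p.map (permAct σ).continuous

/-- The product `f # g = f · g^{f(1)}` of braids. -/
noncomputable def mul (f g : Braid X) : Braid X where
  perm := g.perm * f.perm
  path := f.path.trans (actPath f.perm g.path)

/-- The constant braid. -/
noncomputable def one (X : Set ℂ) : Braid X where
  perm := 1
  path := Path.refl (basePoint X)

theorem permAct_inv_permPoint (σ : Equiv.Perm X) :
    permAct σ⁻¹ (permPoint σ) = basePoint X := by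
  rw [permAct_permPoint, mul_inv_cancel]; rfl

/-- The inverse braid `(f⁻)^σ`, where `f⁻` is the reversed path and `σ = f(1)⁻¹`. -/
noncomputable def inv (f : Braid X) : Braid X where
  perm := f.perm⁻¹
  path := (actPath f.perm⁻¹ f.path.symm).cast (permAct_inv_permPoint f.perm).symm rfl

theorem mul_congr {f f' g g' : Braid X} (hf : Equivalent f f') (hg : Equivalent g g') :
    Equivalent (mul f g) (mul f' g') := by
  have h1 := hf.perm_eq
  have h2 := hg.perm_eq
  obtain ⟨σ, p⟩ := f
  obtain ⟨σ', p'⟩ := f'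
  obtain ⟨τ, q⟩ := g
  obtain ⟨τ', q'⟩ := g'
  obtain rfl : σ = σ' := h1
  obtain rfl : τ = τ' := h2
  exact Path.Homotopic.hcomp (equivalent_mk.1 hf)
    (Path.Homotopic.map (equivalent_mk.1 hg) (permAct σ))

theorem mul_assoc_equiv (f g h : Braid X) :
    Equivalent (mul (mul f g) h) (mul f (mul g h)) := by
  have key := (⟨Path.Homotopy.transAssoc f.path (actPath f.perm g.path)
    (actPath (g.perm * f.perm) h.path)⟩ : Path.Homotopic _ _)
  have e : (mul f (mul g h)).path = f.path.trans ((actPath f.perm g.path).trans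
    (actPath (g.perm * f.perm) h.path)) :=
    congrArg (fun q => f.path.trans q)
      (Path.map_trans g.path (actPath g.perm h.path) (permAct f.perm).continuous)
  unfold Equivalent
  rw [e]
  exact key

theorem one_mul_equiv (f : Braid X) : Equivalent (mul (one X) f) f :=
  (⟨Path.Homotopy.reflTrans f.path⟩ : Path.Homotopic _ _)

theorem mul_one_equiv (f : Braid X) : Equivalent (mul f (one X)) f :=
  (⟨Path.Homotopy.transRefl f.path⟩ : Path.Homotopic _ _)

theorem inv_mul_equiv (f : Braid X) : Equivalent (mul (inv f) f) (one X) := by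
  have key := (⟨Path.Homotopy.reflSymmTrans (actPath f.perm⁻¹ f.path)⟩ : Path.Homotopic _ _)
  have e : (mul (inv f) f).path.toContinuousMap =
    ((actPath f.perm⁻¹ f.path).symm.trans (actPath f.perm⁻¹ f.path)).toContinuousMap := rfl
  have e' : (one X).path.toContinuousMap =
      (Path.refl (permAct f.perm⁻¹ (permPoint f.perm))).toContinuousMap := by
    rw [permAct_inv_permPoint]; rfl
  unfold Equivalent
  rw [e, e']
  exact ContinuousMap.HomotopicRel.symm key

theorem inv_congr {f f' : Braid X} (hf : Equivalent f f') : Equivalent (inv f) (inv f') := by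
  have h1 := hf.perm_eq
  obtain ⟨σ, p⟩ := f
  obtain ⟨σ', p'⟩ := f'
  obtain rfl : σ = σ' := h1
  exact Path.Homotopic.map (Path.Homotopic.symm₂ (equivalent_mk.1 hf)) (permAct σ⁻¹)

end Braid

/-- The braid group `B_X`: equivalence classes of `X`-braids, with `[f][g] = [f # g]`. -/
def BraidGroup (X : Set ℂ) : Type := Quotient (Braid.setoid X)

noncomputable instance (X : Set ℂ) : Group (BraidGroup X) where
  mul := Quotient.map₂ Braid.mul fun _ _ h _ _ k => Braid.mul_congr h k
  one := Quotient.mk _ (Braid.one X)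
  inv := Quotient.map Braid.inv fun _ _ h => Braid.inv_congr h
  mul_assoc := by
    rintro ⟨f⟩ ⟨g⟩ ⟨h⟩
    exact Quotient.sound (Braid.mul_assoc_equiv f g h)
  one_mul := by
    rintro ⟨f⟩
    exact Quotient.sound (Braid.one_mul_equiv f)
  mul_one := by
    rintro ⟨f⟩
    exact Quotient.sound (Braid.mul_one_equiv f)
  inv_mul_cancel := by
    rintro ⟨f⟩
    exact Quotient.sound (Braid.inv_mul_equiv f)

/-- The set `ω = {0, 1, 2, …}` of non-negative integers as a subset of `ℂ`. -/
def omega : Set ℂ := Set.range (fun n : ℕ => (n : ℂ))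

/-- The abelianization of `B_ω`, written additively. -/
abbrev OmegaBraidAb : Type := Additive (Abelianization (BraidGroup omega))

/-- `A` is complete modulo its Ulm subgroup: every sequence `x₁, x₂, …` such that `n!` divides
`x_{n+1} - x_n` has a limit `z` such that `n!` divides `z - x_n`, for all `n > 0`. -/
def IsCompleteModUlm (A : Type*) [AddCommGroup A] : Prop :=
  ∀ x : ℕ → A, (∀ n : ℕ, 0 < n → ∃ y : A, x (n + 1) - x n = n.factorial • y) →
    ∃ z : A, ∀ n : ℕ, 0 < n → ∃ y : A, z - x n = n.factorial • y

/-- `A` is cotorsion: `Ext(J, A) = 0` for every torsion-free abelian group `J`, that is, every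
short exact sequence `0 → A → E → J → 0` of abelian groups with `J` torsion-free splits. -/
def IsCotorsion.{u} (A : Type u) [AddCommGroup A] : Prop :=
  ∀ (E J : Type u) [AddCommGroup E] [AddCommGroup J] [IsAddTorsionFree J]
    (i : A →+ E) (p : E →+ J), Function.Injective i → Function.Exact i p →
    Function.Surjective p → ∃ r : E →+ A, r.comp i = AddMonoidHom.id A

end InfBraid

/-! ### Algebra: solvable recursions imply completeness and cotorsion -/

namespace InfBraid

/-! Both claims follow from one property of A (`SolvesRecursions`): every infinite system z_n = a_n
+ k_n z_{n+1} has a solution in A.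

Algebraic half. Completeness is the system whose a_n are the quotients (x_{n+1} - x_n)/n!. For
cotorsion, take by Zorn's lemma a maximal K meeting A trivially with K + A pure in E. If e is not in
K + A, the purification of K + A + ℤe is, modulo K + A, a union of cyclic groups with g_n ≡ k_n
g_{n+1}. The A-parts a_n of the errors give a recursion, and its solution corrects the g_n so that
the relations hold modulo K, which enlarges K.

Topological half. If a_n is the class of a loop b_n keeping the strings 0, …, n at rest, the
products c_n = b_n · (c_{n+1})^{k_n} converge, since each string is moved by finitely many factors
and F_ω carries the product topology; their classes solve the system. Such b_n exist
(`restingClasses_eq_top`): Sym(ω) is perfect, so every class comes from a loop; after a shrinking,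
an isotopy supported near 0, …, n brings these strings to rest. The correction it introduces in A is
conjugate, by a half turn, to a braid resting on 0, …, n. -/

/-- Every system of equations `z n = a n + k n • z (n + 1)` has a solution in `A`. -/
def SolvesRecursions (A : Type*) [AddCommGroup A] : Prop :=
  ∀ (a : ℕ → A) (k : ℕ → ℕ), ∃ z : ℕ → A, ∀ n, z n = a n + k n • z (n + 1)

theorem SolvesRecursions.isCompleteModUlm {A : Type*} [AddCommGroup A]
    (hA : SolvesRecursions A) : IsCompleteModUlm A := by
  intro x hx
  choose! y hy using hx
  -- The index is shifted because divisibility starts at n = 1. The invariant is x 1 + z 0 - x (m +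
  -- 1) = (m + 1)! • z m, and the coefficient m + 2 turns (m + 1)! into (m + 2)!.
  obtain ⟨z, hz⟩ := hA (fun n => y (n + 1)) (fun n => n + 2)
  refine ⟨x 1 + z 0, fun n hn => ?_⟩
  obtain ⟨m, rfl⟩ := Nat.exists_eq_succ_of_ne_zero hn.ne'
  refine ⟨z m, ?_⟩
  clear hn
  induction m with
  | zero => simp
  | succ m ih =>
    have h1 := hy (m + 1) (Nat.succ_pos m)
    have h2 := hz m
    have e : x 1 + z 0 - x (m + 1 + 1)
        = (x 1 + z 0 - x (m + 1)) - (x (m + 1 + 1) - x (m + 1)) := by abel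
    simp only [Nat.succ_eq_add_one] at ih ⊢
    rw [e, ih, h1, h2, smul_add, add_sub_cancel_left, smul_smul, Nat.factorial_succ (m + 1),
      mul_comm (m + 1 + 1)]

section Cotorsion

variable {E : Type*} [AddCommGroup E]

/-- `E / G` is torsion-free. -/
def IsPureSubgroup (G : AddSubgroup E) : Prop :=
  ∀ (m : ℕ) (y : E), m ≠ 0 → m • y ∈ G → y ∈ G

theorem IsPureSubgroup.zsmul {G : AddSubgroup E} (hG : IsPureSubgroup G) {m : ℤ} (hm : m ≠ 0)
    {y : E} (h : m • y ∈ G) : y ∈ G := by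
  refine hG m.natAbs y (by simpa using hm) ?_
  rcases Int.natAbs_eq m with h' | h'
  · rw [h', natCast_zsmul] at h; exact h
  · rw [h', neg_zsmul, natCast_zsmul] at h; exact neg_mem_iff.1 h

/-- The elements `y` with `N • y ∈ G + ℤ e` form a cyclic group modulo `G`. -/
theorem IsPureSubgroup.exists_generator {G : AddSubgroup E} (hG : IsPureSubgroup G) (e : E)
    {N : ℕ} (hN : N ≠ 0) :
    ∃ (d : ℕ) (g : E), 0 < d ∧ N • g - d • e ∈ G ∧
      ∀ (m : ℤ) (y : E), N • y - m • e ∈ G → ∃ q : ℤ, m = q * d ∧ y - q • g ∈ G := by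
  classical
  have hex : ∃ d : ℕ, 0 < d ∧ ∃ g : E, N • g - d • e ∈ G :=
    ⟨N, Nat.pos_of_ne_zero hN, e, by simp⟩
  obtain ⟨hd, g, hg⟩ := Nat.find_spec hex
  set d := Nat.find hex with hd_def
  refine ⟨d, g, hd, hg, fun m y hy => ?_⟩
  have hd0 : (d : ℤ) ≠ 0 := by exact_mod_cast hd.ne'
  -- Division with remainder: subtracting multiples of g replaces m by m % d, which must vanish
  -- because d is minimal.
  have key : N • (y - (m / d) • g) - (m % d) • e ∈ G := by
    have e1 : N • (y - (m / d) • g) - (m % d) • e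
        = (N • y - m • e) - (m / d) • (N • g - d • e) := by
      have hm : m • e = (m % d) • e + (m / d) • (d • e) := by
        rw [← natCast_zsmul e d, smul_smul, ← add_smul, mul_comm, Int.emod_add_mul_ediv]
      rw [hm, smul_sub, smul_sub, smul_comm N (m / (d : ℤ)) g]
      abel
    rw [e1]
    exact G.sub_mem hy (G.zsmul_mem hg _)
  have hr : m % d = 0 := by
    by_contra hne
    have h0 := Int.emod_nonneg m hd0
    have h1 := Int.emod_lt_of_pos m (by exact_mod_cast hd : (0 : ℤ) < d)
    obtain ⟨r, hr⟩ := Int.eq_ofNat_of_zero_le h0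
    have hlt : r < d := by omega
    refine Nat.find_min hex hlt ⟨by omega, y - (m / d) • g, ?_⟩
    rw [hr, natCast_zsmul] at key
    exact key
  refine ⟨m / d, (Int.ediv_mul_cancel (Int.dvd_of_emod_eq_zero hr)).symm, ?_⟩
  rw [hr, zero_smul, sub_zero] at key
  exact hG N _ hN key

/-- The purification of `G + ℤ e` is, modulo the pure subgroup `G`, an ascending union of infinite
cyclic groups. -/
theorem IsPureSubgroup.exists_rank_one {G : AddSubgroup E} (hG : IsPureSubgroup G) {e : E}
    (he : e ∉ G) :
    ∃ (g : ℕ → E) (k : ℕ → ℕ), (∀ n, g n - k n • g (n + 1) ∈ G) ∧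
      (∀ n (m : ℤ), m • g n ∈ G → m = 0) ∧
      (∀ (c : ℕ) (y : E), c ≠ 0 → (∃ n, ∃ m : ℤ, c • y - m • g n ∈ G) →
        ∃ n, ∃ m : ℤ, y - m • g n ∈ G) ∧
      ∃ n, ∃ m : ℤ, e - m • g n ∈ G := by
  -- Modulo G, g n generates the group of y with n! • y ∈ G + ℤ e; these groups increase with n.
  choose d g hd hg hgen using fun n : ℕ => hG.exists_generator e (Nat.factorial_ne_zero n)
  have hstep : ∀ n, ∃ k : ℕ, g n - k • g (n + 1) ∈ G := by
    intro n
    have h1 : (n + 1).factorial • g n - (((n + 1) * d n : ℕ) : ℤ) • e ∈ G := by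
      have := G.nsmul_mem (hg n) (n + 1)
      rw [smul_sub, smul_smul, smul_smul, ← Nat.factorial_succ] at this
      rwa [natCast_zsmul]
    obtain ⟨q, hq, hq'⟩ := hgen (n + 1) _ _ h1
    have hq0 : 0 ≤ q := by
      by_contra hneg
      have h2 : (0 : ℤ) < d (n + 1) := by exact_mod_cast hd (n + 1)
      have h3 : (0 : ℤ) ≤ (((n + 1) * d n : ℕ) : ℤ) := Int.natCast_nonneg _
      nlinarith
    lift q to ℕ using hq0
    exact ⟨q, by rwa [natCast_zsmul] at hq'⟩
  choose k hk using hstep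
  refine ⟨g, k, hk, ?_, ?_, ?_⟩
  · intro n m hm
    by_contra hne
    have h1 : g n ∈ G := hG.zsmul hne hm
    have h2 : d n • e ∈ G := by
      have := G.sub_mem (G.nsmul_mem h1 n.factorial) (hg n)
      rwa [sub_sub_cancel] at this
    exact he (hG _ _ (hd n).ne' h2)
  · rintro c y hc ⟨n, m, hy⟩
    have h1 : (n.factorial * c) • y - (m * d n) • e ∈ G := by
      have := G.add_mem (G.nsmul_mem hy n.factorial) (G.zsmul_mem (hg n) m)
      rw [smul_sub, smul_sub, smul_comm m n.factorial, sub_add_sub_cancel, smul_smul,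
        ← natCast_zsmul e, smul_smul] at this
      exact this
    set N := n.factorial * c with hN
    have hN0 : N ≠ 0 := Nat.mul_ne_zero (Nat.factorial_ne_zero n) hc
    obtain ⟨r, hr⟩ := Nat.dvd_factorial (Nat.pos_of_ne_zero hN0) le_rfl
    have h2 : N.factorial • y - ((r : ℤ) * (m * d n)) • e ∈ G := by
      have := G.nsmul_mem h1 r
      rw [smul_sub, smul_smul, mul_comm r, ← hr, ← natCast_zsmul _ r, smul_smul] at this
      exact this
    -- A multiple N • y lies in G + ℤ e, hence so does N! • y, and y already appears at level N.
    obtain ⟨q, -, hq⟩ := hgen N _ _ h2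
    exact ⟨N, q, hq⟩
  · obtain ⟨q, -, hq⟩ := hgen 0 1 e (by simp)
    exact ⟨0, q, hq⟩

/-- A subgroup `K` of `E` which meets `A` trivially and for which `K + A` is pure can be enlarged,
keeping both properties, as long as `K + A ≠ E`. -/
theorem exists_larger_partial_complement {A : Type*} [AddCommGroup A] (hA : SolvesRecursions A)
    (i : A →+ E) {K : AddSubgroup E} (hK : Disjoint K i.range)
    (hpure : IsPureSubgroup (K ⊔ i.range))
    {e : E} (he : e ∉ K ⊔ i.range) :
    ∃ K' : AddSubgroup E, K ≤ K' ∧ Disjoint K' i.range ∧ IsPureSubgroup (K' ⊔ i.range) ∧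
      e ∈ K' ⊔ i.range := by
  obtain ⟨g, k, hstep, hindep, hsat, hmem⟩ := hpure.exists_rank_one he
  choose κ hκ b hb hκb using fun n => AddSubgroup.mem_sup.1 (hstep n)
  choose a ha using hb
  obtain ⟨z, hz⟩ := hA a k
  -- The error of the relation at n is i (a n) modulo K; since z n = a n + k n • z (n + 1), the
  -- shift by i (z n) cancels it exactly.
  set g' : ℕ → E := fun n => g n - i (z n) with hg'
  have hg'step : ∀ n, g' n - k n • g' (n + 1) ∈ K := by
    intro n
    have : g' n - k n • g' (n + 1) = κ n := by
      have h1 := hκb n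
      rw [← ha n] at h1
      simp only [hg']
      rw [hz n, map_add, map_nsmul, smul_sub]
      have h2 : g n = κ n + i (a n) + k n • g (n + 1) := by rw [h1]; abel
      rw [h2]; abel
    rw [this]; exact hκ n
  have hmono : ∀ n l y, (∃ m : ℤ, y - m • g' n ∈ K) → ∃ m : ℤ, y - m • g' (n + l) ∈ K := by
    intro n l y h
    induction l with
    | zero => exact h
    | succ l ih =>
      obtain ⟨m, hm⟩ := ih
      refine ⟨m * k (n + l), ?_⟩
      have := K.add_mem hm (K.zsmul_mem (hg'step (n + l)) m)
      rwa [smul_sub m (g' (n + l)), sub_add_sub_cancel, ← natCast_zsmul, smul_smul] at this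
  have hcommon : ∀ n n' y y', (∃ m : ℤ, y - m • g' n ∈ K) → (∃ m : ℤ, y' - m • g' n' ∈ K) →
      ∃ N, (∃ m : ℤ, y - m • g' N ∈ K) ∧ ∃ m : ℤ, y' - m • g' N ∈ K := fun n n' y y' h h' =>
    ⟨n + n', hmono n n' y h, by rw [add_comm n n']; exact hmono n' n y' h'⟩
  let K' : AddSubgroup E :=
    { carrier := {y | ∃ n, ∃ m : ℤ, y - m • g' n ∈ K}
      zero_mem' := ⟨0, 0, by simp⟩
      add_mem' := by
        rintro y y' ⟨n, h⟩ ⟨n', h'⟩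
        obtain ⟨N, ⟨m, hm⟩, m', hm'⟩ := hcommon n n' y y' h h'
        refine ⟨N, m + m', ?_⟩
        have := K.add_mem hm hm'
        rwa [show y - m • g' N + (y' - m' • g' N) = y + y' - (m + m') • g' N by
          rw [add_smul]; abel] at this
      neg_mem' := by
        rintro y ⟨n, m, h⟩
        refine ⟨n, -m, ?_⟩
        have := K.neg_mem h
        rwa [show -(y - m • g' n) = -y - -m • g' n by rw [neg_smul]; abel] at this }
  have hsup : ∀ y, y ∈ K' ⊔ i.range ↔ ∃ n, ∃ m : ℤ, y - m • g n ∈ K ⊔ i.range := by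
    intro y
    constructor
    · intro hy
      obtain ⟨u, ⟨n, m, hu⟩, v, hv, rfl⟩ := AddSubgroup.mem_sup.1 hy
      refine ⟨n, m, ?_⟩
      have : u + v - m • g n = (u - m • g' n) + (v - i (m • z n)) := by
        simp only [hg', smul_sub, map_zsmul]; abel
      rw [this]
      exact add_mem (AddSubgroup.mem_sup_left hu)
        (AddSubgroup.mem_sup_right (sub_mem hv ⟨_, rfl⟩))
    · rintro ⟨n, m, hy⟩
      obtain ⟨u, hu, v, hv, huv⟩ := AddSubgroup.mem_sup.1 hy
      have : y = (u + m • g' n) + (v + i (m • z n)) := by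
        rw [eq_add_of_sub_eq huv.symm]
        simp only [hg', smul_sub, map_zsmul]; abel
      rw [this]
      exact add_mem (AddSubgroup.mem_sup_left ⟨n, m, by simpa using hu⟩)
        (AddSubgroup.mem_sup_right (add_mem hv ⟨_, rfl⟩))
  refine ⟨K', fun y hy => ⟨0, 0, by simpa using hy⟩, ?_, ?_, (hsup e).2 hmem⟩
  · rw [AddSubgroup.disjoint_def]
    rintro y ⟨n, m, hy⟩ hyA
    have hm : m = 0 := by
      refine hindep n m ?_
      have : m • g n = -(y - m • g' n) + (y + i (m • z n)) := by
        simp only [hg', smul_sub, map_zsmul]; abel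
      rw [this]
      exact add_mem (AddSubgroup.mem_sup_left (neg_mem hy))
        (AddSubgroup.mem_sup_right (add_mem hyA ⟨_, rfl⟩))
    rw [hm, zero_smul, sub_zero] at hy
    exact AddSubgroup.disjoint_def.1 hK hy hyA
  · intro c y hc hy
    exact (hsup y).2 (hsat c y hc ((hsup _).1 hy))

/-- Zorn's lemma applies because both conditions on K involve finitely many elements at a time, so
they survive unions of chains; `exists_larger_partial_complement` forces a maximal K to be a full
complement. -/
theorem exists_complement {A : Type*} [AddCommGroup A] (hA : SolvesRecursions A) (i : A →+ E)
    (hpure : IsPureSubgroup i.range) :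
    ∃ K : AddSubgroup E, Disjoint K i.range ∧ K ⊔ i.range = ⊤ := by
  obtain ⟨K, -, ⟨hK, hKp⟩, hmax⟩ := zorn_le_nonempty₀
    {K : AddSubgroup E | Disjoint K i.range ∧ IsPureSubgroup (K ⊔ i.range)} (by
      rintro c hc hchain K₀ hK₀
      have hdir : DirectedOn (· ≤ ·) c := hchain.directedOn
      have hmem : ∀ y, y ∈ sSup c ↔ ∃ K ∈ c, y ∈ K := fun y =>
        AddSubgroup.mem_sSup_of_directedOn ⟨K₀, hK₀⟩ hdir
      refine ⟨sSup c, ⟨?_, ?_⟩, fun K hK => le_sSup hK⟩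
      · rw [AddSubgroup.disjoint_def]
        intro y hy hyA
        obtain ⟨K, hKc, hyK⟩ := (hmem y).1 hy
        exact AddSubgroup.disjoint_def.1 (hc hKc).1 hyK hyA
      · intro m y hm hy
        obtain ⟨u, hu, v, hv, huv⟩ := AddSubgroup.mem_sup.1 hy
        obtain ⟨K, hKc, huK⟩ := (hmem u).1 hu
        have := (hc hKc).2 m y hm (huv ▸ add_mem (AddSubgroup.mem_sup_left huK)
          (AddSubgroup.mem_sup_right hv))
        exact sup_le_sup_right (le_sSup hKc) _ this)
    ⊥ ⟨disjoint_bot_left, by rwa [bot_sup_eq]⟩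
  refine ⟨K, hK, ?_⟩
  by_contra hne
  obtain ⟨e, he⟩ : ∃ e, e ∉ K ⊔ i.range := by
    by_contra! hall
    exact hne ((AddSubgroup.eq_top_iff' _).2 hall)
  obtain ⟨K', hle, hd, hp, he'⟩ := exists_larger_partial_complement hA i hK hKp he
  exact he (sup_le_sup_right (hmax ⟨hd, hp⟩ hle) _ he')

end Cotorsion

theorem SolvesRecursions.isCotorsion {A : Type*} [AddCommGroup A] (hA : SolvesRecursions A) :
    IsCotorsion A := by
  intro E J _ _ _ i p hi hexact _
  have hpure : IsPureSubgroup i.range := by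
    intro m y hm hy
    obtain ⟨a, ha⟩ := hy
    have h1 : p (m • y) = 0 := (hexact _).2 ⟨a, ha⟩
    rw [map_nsmul] at h1
    exact (hexact y).1 ((nsmul_eq_zero_iff_right hm).1 h1)
  obtain ⟨K, hd, htop⟩ := exists_complement hA i hpure
  have hex : ∀ y : E, ∃ a : A, y - i a ∈ K := by
    intro y
    obtain ⟨u, hu, v, ⟨a, rfl⟩, huv⟩ := AddSubgroup.mem_sup.1 (htop ▸ AddSubgroup.mem_top y)
    exact ⟨a, by rw [← huv, add_sub_cancel_right]; exact hu⟩
  choose r hr using hex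
  have huniq : ∀ y a, y - i a ∈ K → r y = a := by
    intro y a h
    refine hi (sub_eq_zero.1 (AddSubgroup.disjoint_def.1 hd ?_ (sub_mem ⟨_, rfl⟩ ⟨_, rfl⟩)))
    have := K.sub_mem h (hr y)
    rwa [sub_sub_sub_cancel_left] at this
  refine ⟨AddMonoidHom.mk' r fun y y' => huniq _ _ ?_, ?_⟩
  · rw [map_add, add_sub_add_comm]
    exact K.add_mem (hr y) (hr y')
  · ext a
    exact huniq _ _ (by simp)

end InfBraid

/-! ### Perfectness of the symmetric group of a countable set -/

namespace InfBraid

open Equiv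
open scoped commutatorElement

/-- Infinite swindle: let G act as g on the copies j ≥ 0 and let s shift by one. Then s G s⁻¹ acts
as g on the copies j ≥ 1, so ⁅G, s⁆ leaves g on copy 0 only. -/
theorem prodExtendRight_mem_commutator {β : Type*} (g : Perm β) :
    Perm.prodExtendRight (0 : ℤ) g ∈ commutator (Perm (ℤ × β)) := by
  classical
  let G : Perm (ℤ × β) := Equiv.prodShear (Equiv.refl ℤ) fun j => if 0 ≤ j then g else 1
  let s : Perm (ℤ × β) := Equiv.prodCongr (Equiv.addRight 1) (Equiv.refl β)
  have h : Perm.prodExtendRight (0 : ℤ) g = ⁅G, s⁆ := by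
    rw [commutatorElement_def, eq_mul_inv_iff_mul_eq, eq_mul_inv_iff_mul_eq]
    ext1 ⟨j, b⟩
    change Perm.prodExtendRight (0 : ℤ) g (j + 1, (if 0 ≤ j then g else 1) b) =
      (j + 1, (if 0 ≤ j + 1 then g else 1) b)
    rcases lt_trichotomy j (-1) with hj | rfl | hj
    · rw [Perm.prodExtendRight_apply_ne _ (by omega), if_neg (by omega), if_neg (by omega)]
    · norm_num
    · rw [Perm.prodExtendRight_apply_ne _ (by omega), if_pos (by omega), if_pos (by omega)]
  rw [h, commutator_def]
  exact Subgroup.commutator_mem_commutator (Subgroup.mem_top _) (Subgroup.mem_top _)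

theorem map_mem_commutator {G H : Type*} [Group G] [Group H] (φ : G →* H) {g : G}
    (hg : g ∈ commutator G) : φ g ∈ commutator H := by
  have h := Subgroup.mem_map_of_mem φ hg
  rw [commutator_def, Subgroup.map_commutator] at h
  exact Subgroup.commutator_mono le_top le_top h

/-- A permutation of a countable set with infinitely many fixed points lies in the commutator
subgroup. -/
theorem mem_commutator_of_fixed_seq {α : Type*} [Countable α] (g : Perm α) (f : ℕ → α)
    (hf : Function.Injective f) (hg : ∀ n, g (f n) = f n) : g ∈ commutator (Perm α) := by
  classical
  -- T will house the copies j ≠ 0 of Tᶜ, with Tᶜ itself as copy 0. Using only every second fixed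
  -- point keeps Tᶜ infinite.
  set T : Set α := Set.range fun n => f (2 * n) with hT
  have hgT : ∀ x ∈ T, g x = x := by rintro _ ⟨n, rfl⟩; exact hg _
  have hTinf : Infinite T := by
    refine Set.infinite_coe_iff.2 (Set.infinite_range_of_injective fun m n h => ?_)
    have := hf h; omega
  have hodd : ∀ n, f (2 * n + 1) ∈ Tᶜ := by
    rintro n ⟨m, hm⟩
    have := hf hm; omega
  have hSinf : Infinite (Tᶜ : Set α) :=
    Infinite.of_injective (fun n => (⟨f (2 * n + 1), hodd n⟩ : (Tᶜ : Set α))) fun m n h => by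
      have := hf (congrArg Subtype.val h); omega
  have hZ : Infinite {j : ℤ // j ≠ 0} :=
    Infinite.of_injective (fun n : ℕ => (⟨n + 1, by omega⟩ : {j : ℤ // j ≠ 0})) fun m n h => by
      have := congrArg Subtype.val h; simpa using this
  obtain ⟨φ⟩ := nonempty_equiv_of_countable (α := {j : ℤ // j ≠ 0} × (Tᶜ : Set α)) (β := T)
  let ef : ℤ × (Tᶜ : Set α) → α := fun p => if h : p.1 = 0 then p.2 else φ (⟨p.1, h⟩, p.2)
  have ef0 : ∀ s, ef (0, s) = s := fun s => dif_pos rfl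
  have ef1 : ∀ j (h : j ≠ 0) s, ef (j, s) = φ (⟨j, h⟩, s) := fun j h s => dif_neg h
  have hbij : Function.Bijective ef := by
    constructor
    · rintro ⟨j, s⟩ ⟨j', s'⟩ h
      by_cases hj : j = 0 <;> by_cases hj' : j' = 0
      · subst hj hj'
        rw [ef0, ef0] at h
        rw [Subtype.ext h]
      · subst hj
        rw [ef0, ef1 j' hj'] at h
        exact absurd (h ▸ (φ _).2) s.2
      · subst hj'
        rw [ef0, ef1 j hj] at h
        exact absurd (h ▸ (φ _).2) s'.2
      · rw [ef1 j hj, ef1 j' hj'] at h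
        have := φ.injective (Subtype.ext h)
        simpa using this
    · intro x
      by_cases hx : x ∈ T
      · refine ⟨((φ.symm ⟨x, hx⟩).1.1, (φ.symm ⟨x, hx⟩).2), ?_⟩
        rw [ef1 _ (φ.symm ⟨x, hx⟩).1.2]
        simp
      · exact ⟨(0, ⟨x, hx⟩), ef0 _⟩
  let e := Equiv.ofBijective ef hbij
  have hmaps : ∀ x, g x ∈ Tᶜ ↔ x ∈ Tᶜ := by
    intro x
    refine not_congr ⟨fun h => ?_, fun h => by rwa [hgT x h]⟩
    have := g.injective (hgT _ h)
    rwa [← this]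
  have key : g = e.permCongrHom (Perm.prodExtendRight (0 : ℤ) (g.subtypePerm hmaps)) := by
    ext x
    obtain ⟨⟨j, s⟩, rfl⟩ := e.surjective x
    change _ = e (Perm.prodExtendRight (0 : ℤ) (g.subtypePerm hmaps) (e.symm (e (j, s))))
    rw [e.symm_apply_apply]
    change g (ef (j, s)) = ef _
    by_cases hj : j = 0
    · subst hj
      rw [Perm.prodExtendRight_apply_eq, ef0, ef0]; rfl
    · rw [Perm.prodExtendRight_apply_ne _ hj, ef1 j hj]
      exact hgT _ (φ _).2
  rw [key]
  exact map_mem_commutator e.permCongrHom.toMonoidHom (prodExtendRight_mem_commutator _)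

/-- The group of permutations of a countably infinite set is perfect. -/
theorem mem_commutator_perm {α : Type*} [Countable α] [Infinite α] (σ : Perm α) :
    σ ∈ commutator (Perm α) := by
  classical
  by_cases hfix : {x | σ x = x}.Infinite
  · have := Set.infinite_coe_iff.2 hfix
    exact mem_commutator_of_fixed_seq σ (fun n => Infinite.natEmbedding {x | σ x = x} n)
      (fun m n h => (Infinite.natEmbedding _).injective (Subtype.ext h))
      (fun n => (Infinite.natEmbedding {x | σ x = x} n).2)
  -- Otherwise σ moves infinitely many points, and the t n can be chosen with {t n} disjoint from {σ
  -- (t n)}. The involution τ swapping t (2n) with σ (t (2n)) fixes every t (2n + 1), while τ * σ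
  -- fixes every t (2n).
  obtain ⟨t, ht, hrel⟩ := exists_seq_of_forall_finset_exists (fun x => σ x ≠ x)
    (fun x y => y ≠ x ∧ y ≠ σ x ∧ σ y ≠ x) (by
      intro s _
      obtain ⟨y, hy⟩ := ((Set.not_infinite.1 hfix).union ((s.finite_toSet.union
        (s.image σ).finite_toSet).union (s.image σ.symm).finite_toSet)).exists_notMem
      simp only [Set.mem_union, Set.mem_ofPred_eq, Finset.mem_coe, Finset.mem_image, not_or,
        not_exists, not_and] at hy
      refine ⟨y, hy.1, fun x hx => ⟨?_, ?_, ?_⟩⟩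
      · rintro rfl; exact hy.2.1.1 hx
      · rintro rfl; exact hy.2.1.2 x hx rfl
      · intro h; exact hy.2.2 x hx (by rw [← h, σ.symm_apply_apply]))
  have hinj : Function.Injective t := fun m n h => by
    rcases lt_trichotomy m n with hlt | rfl | hlt
    · exact absurd h.symm (hrel m n hlt).1
    · rfl
    · exact absurd h (hrel n m hlt).1
  have hσt : ∀ m n, σ (t m) ≠ t n := fun m n h => by
    rcases lt_trichotomy m n with hlt | rfl | hlt
    · exact (hrel m n hlt).2.1 h.symm
    · exact ht m h
    · exact (hrel n m hlt).2.2 h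
  set T : Set α := Set.range fun n => t (2 * n) with hT
  let τf : α → α := fun x => if x ∈ T then σ x else if σ.symm x ∈ T then σ.symm x else x
  have hτT : ∀ x ∈ T, τf x = σ x := fun x hx => if_pos hx
  have hTσ : ∀ x ∈ T, σ x ∉ T := by
    rintro _ ⟨m, rfl⟩ ⟨n, hn⟩; exact hσt _ _ hn.symm
  have hτσ : ∀ x ∈ T, τf (σ x) = x := fun x hx => by
    simp only [τf]
    rw [if_neg (hTσ x hx), σ.symm_apply_apply, if_pos hx]
  have hinv : Function.Involutive τf := by
    intro x
    by_cases hx : x ∈ T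
    · rw [hτT x hx, hτσ x hx]
    by_cases hx' : σ.symm x ∈ T
    · have h1 : τf x = σ.symm x := by simp only [τf]; rw [if_neg hx, if_pos hx']
      rw [h1, hτT _ hx', σ.apply_symm_apply]
    · have h1 : τf x = x := by simp only [τf]; rw [if_neg hx, if_neg hx']
      rw [h1, h1]
  let τ : Perm α := hinv.toPerm
  have hσ : σ = τ * (τ * σ) := by
    ext x
    exact (hinv (σ x)).symm
  rw [hσ]
  refine mul_mem (mem_commutator_of_fixed_seq τ (fun n => t (2 * n + 1))
    (fun m n h => by have := hinj h; omega) fun n => ?_)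
    (mem_commutator_of_fixed_seq _ (fun n => t (2 * n)) (fun m n h => by have := hinj h; omega)
      fun n => hτσ _ ⟨n, rfl⟩)
  change τf _ = _
  simp only [τf]
  rw [if_neg, if_neg]
  · rintro ⟨m, hm⟩
    exact hσt (2 * m) (2 * n + 1) (by simp only [] at hm; rw [hm, σ.apply_symm_apply])
  · rintro ⟨m, hm⟩
    have := hinj hm; omega

end InfBraid

/-! ### Classes of braids in A and the effect of plane isotopies -/

namespace InfBraid

open unitInterval

namespace Braid

variable {X : Set ℂ}

/-- The class of a braid in the braid group. -/
def toGroup (f : Braid X) : BraidGroup X := Quotient.mk (setoid X) f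

/-- The class of a braid in the abelianized braid group. -/
noncomputable def ab (f : Braid X) : Additive (Abelianization (BraidGroup X)) :=
  Additive.ofMul (Abelianization.of f.toGroup)

theorem ab_congr {f g : Braid X} (h : Equivalent f g) : ab f = ab g :=
  congrArg (fun b => Additive.ofMul (Abelianization.of b)) (Quotient.sound h)

theorem ab_mul (f g : Braid X) : ab (mul f g) = ab f + ab g :=
  congrArg Additive.ofMul (map_mul Abelianization.of f.toGroup g.toGroup)

theorem ab_inv (f : Braid X) : ab (inv f) = -ab f :=
  congrArg Additive.ofMul (map_inv Abelianization.of f.toGroup)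

theorem ab_one : ab (one X) = 0 :=
  congrArg Additive.ofMul (map_one (Abelianization.of (G := BraidGroup X)))

theorem equivalent_of_path_eq {f g : Braid X} (h : ∀ t, f.path t = g.path t) : Equivalent f g := by
  have : f.path.toContinuousMap = g.path.toContinuousMap := ContinuousMap.ext h
  unfold Equivalent
  rw [this]
  exact ContinuousMap.HomotopicRel.refl _

/-- The braid with trivial permutation given by a loop. -/
def ofLoop (p : Path (basePoint X) (basePoint X)) : Braid X := ⟨1, p⟩

theorem ab_ofLoop_trans (p q : Path (basePoint X) (basePoint X)) :
    ab (ofLoop (p.trans q)) = ab (ofLoop p) + ab (ofLoop q) :=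
  (ab_congr (equivalent_of_path_eq fun _ => rfl)).trans (ab_mul (ofLoop p) (ofLoop q))

theorem ab_ofLoop_symm (p : Path (basePoint X) (basePoint X)) :
    ab (ofLoop p.symm) = -ab (ofLoop p) :=
  (ab_congr (equivalent_of_path_eq fun _ => rfl)).trans (ab_inv (ofLoop p))

theorem ab_ofLoop_refl : ab (ofLoop (Path.refl (basePoint X))) = 0 := ab_one

/-- The homomorphism taking a braid to its permutation. -/
def permHom (X : Set ℂ) : BraidGroup X →* (Equiv.Perm X)ᵐᵒᵖ where
  toFun := Quotient.lift (fun f : Braid X => MulOpposite.op f.perm)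
    fun _ _ h => congrArg MulOpposite.op (Equivalent.perm_eq h)
  map_one' := rfl
  map_mul' := by rintro ⟨f⟩ ⟨g⟩; rfl

theorem mul_path_apply (f g : Braid X) (t : I) (x : X) :
    ((mul f g).path t).1 x = if h : (t : ℝ) ≤ 1 / 2
      then (f.path ⟨2 * t, (unitInterval.mul_pos_mem_iff zero_lt_two).2 ⟨t.2.1, h⟩⟩).1 x
      else (g.path ⟨2 * t - 1, unitInterval.two_mul_sub_one_mem_iff.2
        ⟨(not_le.1 h).le, t.2.2⟩⟩).1 (f.perm x) := by
  change ((f.path.trans (actPath f.perm g.path)) t).1 x = _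
  erw [Path.trans_apply]
  split_ifs <;> rfl

theorem path_zero (f : Braid X) (x : X) : (f.path 0).1 x = x := by
  rw [f.path.source]; rfl

theorem path_one (f : Braid X) (x : X) : (f.path 1).1 x = f.perm x := by
  rw [f.path.target]; rfl

end Braid

/-- A continuous family of injective maps `ℂ → ℂ` starting at the identity. -/
structure Isotopy where
  toFun : I → ℂ → ℂ
  continuous_uncurry : Continuous fun p : I × ℂ => toFun p.1 p.2
  injective : ∀ t, Function.Injective (toFun t)
  map_zero : ∀ z, toFun 0 z = z

namespace Isotopy

variable {X : Set ℂ}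

/-- An isotopy moving `X` to itself by the permutation `ρ`, restricted to `X`. -/
noncomputable def toBraid (γ : Isotopy) (ρ : Equiv.Perm X) (h : ∀ x : X, γ.toFun 1 x = ρ x) : Braid X where
  perm := ρ
  path :=
    { toFun := fun t => ⟨fun x => γ.toFun t x, fun _ _ e => Subtype.ext (γ.injective t e)⟩
      continuous_toFun := Continuous.subtype_mk (continuous_pi fun _ =>
        γ.continuous_uncurry.comp (continuous_id.prodMk continuous_const)) _
      source' := Subtype.ext (funext fun x => γ.map_zero x)
      target' := Subtype.ext (funext h) }

/-- The braid `t ↦ γ_t ∘ f(t)`. -/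
noncomputable def apply (γ : Isotopy) (f : Braid X) (ρ : Equiv.Perm X) (h : ∀ x : X, γ.toFun 1 x = ρ x) :
    Braid X where
  perm := ρ * f.perm
  path :=
    { toFun := fun t => ⟨fun x => γ.toFun t ((f.path t).1 x),
        fun _ _ e => (f.path t).2 (γ.injective t e)⟩
      continuous_toFun := Continuous.subtype_mk (continuous_pi fun x =>
        γ.continuous_uncurry.comp (continuous_id.prodMk ((continuous_apply x).comp
          (continuous_subtype_val.comp f.path.continuous)))) _
      source' := Subtype.ext (funext fun x => by
        change γ.toFun 0 ((f.path 0).1 x) = x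
        rw [γ.map_zero, f.path_zero])
      target' := Subtype.ext (funext fun x => by
        change γ.toFun 1 ((f.path 1).1 x) = _
        rw [f.path_one, h]; rfl) }

/-- The braid `t ↦ γ_1 ∘ f(t) ∘ γ_1⁻¹`. -/
noncomputable def conj (γ : Isotopy) (f : Braid X) (ρ : Equiv.Perm X) (h : ∀ x : X, γ.toFun 1 x = ρ x) :
    Braid X where
  perm := ρ * f.perm * ρ.symm
  path :=
    { toFun := fun t => ⟨fun x => γ.toFun 1 ((f.path t).1 (ρ.symm x)),
        fun _ _ e => ρ.symm.injective ((f.path t).2 (γ.injective 1 e))⟩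
      continuous_toFun := Continuous.subtype_mk (continuous_pi fun x =>
        γ.continuous_uncurry.comp (continuous_const.prodMk ((continuous_apply (ρ.symm x)).comp
          (continuous_subtype_val.comp f.path.continuous)))) _
      source' := Subtype.ext (funext fun x => by
        change γ.toFun 1 ((f.path 0).1 (ρ.symm x)) = x
        rw [f.path_zero, h, ρ.apply_symm_apply])
      target' := Subtype.ext (funext fun x => by
        change γ.toFun 1 ((f.path 1).1 (ρ.symm x)) = _
        rw [f.path_one, h]; rfl) }

instance : ContractibleSpace I :=
  (convex_Icc (0 : ℝ) 1).contractibleSpace ⟨0, by simp⟩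

/-- The square `(s, t) ↦ γ_s ∘ f(t)`. -/
noncomputable def square (γ : Isotopy) (f : Braid X) : C(I × I, ConfSpace X) where
  toFun p := ⟨fun x => γ.toFun p.1 ((f.path p.2).1 x),
    fun _ _ e => (f.path p.2).2 (γ.injective p.1 e)⟩
  continuous_toFun := Continuous.subtype_mk (continuous_pi fun x =>
    γ.continuous_uncurry.comp (continuous_fst.prodMk ((continuous_apply x).comp
      (continuous_subtype_val.comp (f.path.continuous.comp continuous_snd))))) _

/-- Two braids factoring through paths in the square with common endpoints are equivalent. -/
theorem equivalent_of_square (γ : Isotopy) (f : Braid X) {u v : I × I} (p q : Path u v)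
    {g g' : Braid X} (hg : ∀ t x, (g.path t).1 x = γ.toFun (p t).1 ((f.path (p t).2).1 x))
    (hg' : ∀ t x, (g'.path t).1 x = γ.toFun (q t).1 ((f.path (q t).2).1 x)) :
    Braid.Equivalent g g' := by
  have hpq := SimplyConnectedSpace.paths_homotopic p q
  have h := hpq.map (γ.square f)
  have e : g.path.toContinuousMap = (p.map (γ.square f).continuous).toContinuousMap :=
    ContinuousMap.ext fun t => Subtype.ext (funext (hg t))
  have e' : g'.path.toContinuousMap = (q.map (γ.square f).continuous).toContinuousMap :=
    ContinuousMap.ext fun t => Subtype.ext (funext (hg' t))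
  unfold Braid.Equivalent
  rw [e, e']
  exact h

/-- The segment `t ↦ (a, t)` in the square. -/
def vertical (a : I) : Path (a, (0 : I)) (a, 1) where
  toFun t := (a, t)
  source' := rfl
  target' := rfl

/-- The segment `t ↦ (t, b)` in the square. -/
def horizontal (b : I) : Path ((0 : I), b) (1, b) where
  toFun t := (t, b)
  source' := rfl
  target' := rfl

/-- The diagonal of the square. -/
def diagonal : Path ((0 : I), (0 : I)) (1, 1) where
  toFun t := (t, t)
  source' := rfl
  target' := rfl

theorem mul_toBraid_factor (γ : Isotopy) (f : Braid X) (ρ : Equiv.Perm X)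
    (h : ∀ x : X, γ.toFun 1 x = ρ x) (t : I) (x : X) :
    ((Braid.mul f (γ.toBraid ρ h)).path t).1 x =
      γ.toFun (((vertical 0).trans (horizontal 1)) t).1
        ((f.path (((vertical 0).trans (horizontal 1)) t).2).1 x) := by
  rw [Braid.mul_path_apply, Path.trans_apply]
  split_ifs
  · exact (γ.map_zero _).symm
  · simp only [horizontal, Path.coe_mk_mk, f.path_one]
    rfl

/-- In the square γ_s ∘ f(t), the diagonal is homotopic to the edge path that performs f first and
then γ; the latter is a product of braids. -/
theorem ab_apply (γ : Isotopy) (f : Braid X) (ρ : Equiv.Perm X)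
    (h : ∀ x : X, γ.toFun 1 x = ρ x) :
    (γ.apply f ρ h).ab = f.ab + (γ.toBraid ρ h).ab := by
  rw [← Braid.ab_mul]
  exact Braid.ab_congr (γ.equivalent_of_square f diagonal _ (fun _ _ => rfl)
    (γ.mul_toBraid_factor f ρ h))

/-- The two edge paths around the square γ_s ∘ f(t) give f # γ ∼ γ # (γ_1 f γ_1⁻¹); commutativity of
A cancels γ. -/
theorem ab_conj (γ : Isotopy) (f : Braid X) (ρ : Equiv.Perm X)
    (h : ∀ x : X, γ.toFun 1 x = ρ x) : (γ.conj f ρ h).ab = f.ab := by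
  have key : (Braid.mul f (γ.toBraid ρ h)).ab = (Braid.mul (γ.toBraid ρ h) (γ.conj f ρ h)).ab := by
    refine Braid.ab_congr (γ.equivalent_of_square f _ ((horizontal 0).trans (vertical 1))
      (γ.mul_toBraid_factor f ρ h) fun t x => ?_)
    rw [Braid.mul_path_apply, Path.trans_apply]
    split_ifs
    · simp only [horizontal, Path.coe_mk_mk, f.path_zero]
      rfl
    · change γ.toFun 1 ((f.path _).1 (ρ.symm (ρ x))) = _
      rw [ρ.symm_apply_apply]; rfl
  rw [Braid.ab_mul, Braid.ab_mul, add_comm] at key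
  exact (add_left_cancel key).symm

end Isotopy

/-- Every permutation of `ω` is the permutation of some braid. -/
theorem permHom_surjective : Function.Surjective (Braid.permHom omega) := by
  intro ρ'
  obtain ⟨ρ, rfl⟩ := MulOpposite.op_surjective ρ'
  have hre : ∀ x : omega, (x : ℂ).im = 0 := by rintro ⟨_, n, rfl⟩; simp
  -- The last term gives distinct points distinct imaginary parts for 0 < t < 1, so the strings
  -- cannot collide.
  let u : I → omega → ℂ := fun t x =>
    (1 - (t : ℝ)) * (x : ℂ) + (t : ℝ) * (ρ x : ℂ) + (t : ℝ) * (1 - (t : ℝ)) * (x : ℂ) * Complex.I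
  have hext : ∀ x y : omega, (x : ℂ).re = (y : ℂ).re → x = y := fun x y h =>
    Subtype.ext (Complex.ext h (by rw [hre, hre]))
  have huim : ∀ t x, (u t x).im = t * (1 - t) * (x : ℂ).re := by
    intro t x
    simp [u, hre]
  have h0 : ∀ x, u 0 x = x := by intro x; simp [u]
  have h1 : ∀ x, u 1 x = ρ x := by intro x; simp [u]
  have hu : ∀ t, Function.Injective (u t) := by
    intro t x y h
    by_cases ht0 : t = 0
    · subst ht0; rw [h0, h0] at h; exact Subtype.ext h
    by_cases ht1 : t = 1
    · subst ht1; rw [h1, h1] at h; exact ρ.injective (Subtype.ext h)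
    have him := congrArg Complex.im h
    rw [huim, huim] at him
    have hpos : (t : ℝ) * (1 - t) ≠ 0 :=
      mul_ne_zero (fun e => ht0 (Subtype.ext e)) (fun e => ht1 (Subtype.ext (by
        change (t : ℝ) = 1; linarith)))
    exact hext x y (mul_left_cancel₀ hpos him)
  let f : Braid omega :=
    { perm := ρ
      path :=
        { toFun := fun t => ⟨u t, hu t⟩
          continuous_toFun := Continuous.subtype_mk (continuous_pi fun x => by
            simp only [u]; fun_prop) _
          source' := Subtype.ext (funext h0)
          target' := Subtype.ext (funext h1) } }
  exact ⟨Quotient.mk _ f, rfl⟩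

instance : Infinite omega :=
  Set.infinite_coe_iff.2 (Set.infinite_range_of_injective Nat.cast_injective)

instance : Countable omega := (Set.countable_range _).to_subtype

/-- Since Sym(ω) is perfect and every permutation is realized, some element of the commutator
subgroup has the same permutation as a given braid; dividing by it leaves a pure braid of the same
class. -/
theorem exists_ofLoop_eq (a : OmegaBraidAb) :
    ∃ p : Path (basePoint omega) (basePoint omega), (Braid.ofLoop p).ab = a := by
  obtain ⟨g, rfl⟩ : ∃ g : BraidGroup omega, Additive.ofMul (Abelianization.of g) = a := by
    obtain ⟨g, hg⟩ := QuotientGroup.mk_surjective (Additive.toMul a)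
    exact ⟨g, congrArg Additive.ofMul hg⟩
  have hc : Braid.permHom omega g ∈ Subgroup.map (Braid.permHom omega) (commutator _) := by
    rw [commutator_def, Subgroup.map_commutator, ← MonoidHom.range_eq_map,
      MonoidHom.range_eq_top.2 permHom_surjective, ← commutator_def]
    -- Inversion identifies the group with its opposite, so perfectness is applied to the inverse
    -- permutation.
    have h2 := map_mem_commutator (MulEquiv.inv' (Equiv.Perm omega)).toMonoidHom
      (mem_commutator_perm (MulOpposite.unop (Braid.permHom omega g))⁻¹)
    convert h2
    simp
  obtain ⟨k, hk, hkg⟩ := hc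
  have hof : Abelianization.of (g * k⁻¹) = Abelianization.of g := by
    have h1 : Abelianization.of k = 1 := by
      rw [← MonoidHom.mem_ker, Abelianization.ker_of]; exact hk
    rw [map_mul, map_inv, h1, inv_one, mul_one]
  have hperm : Braid.permHom omega (g * k⁻¹) = 1 := by rw [map_mul, map_inv, hkg, mul_inv_cancel]
  rw [← hof]
  generalize g * k⁻¹ = b at hperm
  induction b using Quotient.inductionOn with | _ f => ?_
  obtain ⟨ρ, p⟩ := f
  obtain rfl : ρ = 1 := MulOpposite.op_injective hperm
  exact ⟨p, rfl⟩

end InfBraid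

/-! ### Construction of the plane isotopies -/

namespace InfBraid

open unitInterval Filter Topology

section PullBack

variable {ι : Type*} [Fintype ι]

/-- The map pushing `c i` by `-v i`, cut off at distance `ε` from the points `c i`. -/
noncomputable def pushBack (ε : ℝ) (c v : ι → ℂ) (z : ℂ) : ℂ :=
  z - ∑ i, (max 0 (1 - ‖z - c i‖ / ε)) • v i

/-- Each cutoff is 1/ε-Lipschitz, so the displacement has Lipschitz constant at most ∑ ‖v i‖ / ε <
1; the identity minus a contraction is injective. -/
theorem pushBack_injective {ε : ℝ} (hε : 0 < ε) {c v : ι → ℂ} (hv : ∑ i, ‖v i‖ < ε) :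
    Function.Injective (pushBack ε c v) := by
  intro z w h
  by_contra hne
  have hpos : 0 < ‖z - w‖ := norm_pos_iff.2 (sub_ne_zero.2 hne)
  have h1 : z - w = ∑ i, (max 0 (1 - ‖z - c i‖ / ε) - max 0 (1 - ‖w - c i‖ / ε)) • v i := by
    simp only [sub_smul, Finset.sum_sub_distrib]
    unfold pushBack at h
    linear_combination h
  have h2 : ∀ i, |max 0 (1 - ‖z - c i‖ / ε) - max 0 (1 - ‖w - c i‖ / ε)| ≤ ‖z - w‖ / ε := by
    intro i
    have h3 : |max 0 (1 - ‖z - c i‖ / ε) - max 0 (1 - ‖w - c i‖ / ε)|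
        ≤ |(1 - ‖z - c i‖ / ε) - (1 - ‖w - c i‖ / ε)| := by
      have := abs_max_sub_max_le_abs (1 - ‖z - c i‖ / ε) (1 - ‖w - c i‖ / ε) 0
      rwa [max_comm _ (0 : ℝ), max_comm _ (0 : ℝ)] at this
    refine h3.trans ?_
    rw [show (1 - ‖z - c i‖ / ε) - (1 - ‖w - c i‖ / ε) = (‖w - c i‖ - ‖z - c i‖) / ε by ring,
      abs_div, abs_of_pos hε]
    refine div_le_div_of_nonneg_right ?_ hε.le
    have := abs_norm_sub_norm_le (w - c i) (z - c i)
    rwa [sub_sub_sub_cancel_right, norm_sub_rev w z] at this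
  have h3 : ‖z - w‖ ≤ ‖z - w‖ / ε * ∑ i, ‖v i‖ := by
    calc ‖z - w‖ = ‖∑ i, (max 0 (1 - ‖z - c i‖ / ε) - max 0 (1 - ‖w - c i‖ / ε)) • v i‖ := by
          rw [← h1]
      _ ≤ ∑ i, ‖z - w‖ / ε * ‖v i‖ := by
          refine norm_sum_le_of_le _ fun i _ => ?_
          rw [norm_smul, Real.norm_eq_abs]
          exact mul_le_mul_of_nonneg_right (h2 i) (norm_nonneg _)
      _ = _ := (Finset.mul_sum _ _ _).symm
  have h4 : ‖z - w‖ / ε * ∑ i, ‖v i‖ < ‖z - w‖ / ε * ε :=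
    mul_lt_mul_of_pos_left hv (div_pos hpos hε)
  rw [div_mul_cancel₀ _ hε.ne'] at h4
  exact absurd (h3.trans_lt h4) (lt_irrefl _)

theorem pushBack_center {ε : ℝ} (hε : 0 < ε) {c v : ι → ℂ}
    (hc : ∀ i j, i ≠ j → ε ≤ ‖c i - c j‖) (i : ι) : pushBack ε c v (c i) = c i - v i := by
  classical
  unfold pushBack
  rw [Finset.sum_eq_single i]
  · simp
  · intro j _ hj
    rw [max_eq_left, zero_smul]
    rw [sub_nonpos, one_le_div hε]
    exact hc i j hj.symm
  · simp

theorem pushBack_far {ε : ℝ} (hε : 0 < ε) {c v : ι → ℂ} {z : ℂ}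
    (hz : ∀ i, ε ≤ ‖z - c i‖) : pushBack ε c v z = z := by
  unfold pushBack
  rw [Finset.sum_eq_zero, sub_zero]
  intro i _
  rw [max_eq_left, zero_smul]
  rw [sub_nonpos, one_le_div hε]
  exact hz i

theorem eventually_forall_le_of_pos {f : I → ℝ} (hf : Continuous f) (hpos : ∀ t, 0 < f t) :
    ∀ᶠ ε in 𝓝[>] (0 : ℝ), ∀ t, ε ≤ f t := by
  obtain ⟨t₀, -, ht₀⟩ := isCompact_univ.exists_isMinOn Set.univ_nonempty hf.continuousOn
  filter_upwards [nhdsWithin_le_nhds (Iio_mem_nhds (hpos t₀))] with ε hε t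
  exact hε.le.trans (ht₀ (Set.mem_univ t))

/-- The motion of finitely many points within a disk can be undone by an isotopy of the plane
supported in that disk. -/
theorem exists_isotopy_pullback (u : ι → C(I, ℂ)) (hu : ∀ t, Function.Injective fun i => u i t)
    (R : ℝ) (hR : ∀ i t, ‖u i t‖ < R) :
    ∃ γ : Isotopy, (∀ i t, γ.toFun t (u i t) = u i 0) ∧
      ∀ t z, R ≤ ‖z‖ → γ.toFun t z = z := by
  obtain ⟨ε, hε, hsep, hfar⟩ : ∃ ε : ℝ, 0 < ε ∧ (∀ t i j, i ≠ j → ε ≤ ‖u i t - u j t‖) ∧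
      ∀ t i, ε ≤ R - ‖u i t‖ := by
    have h1 : ∀ᶠ ε in 𝓝[>] (0 : ℝ), ∀ i j, i ≠ j → ∀ t, ε ≤ ‖u i t - u j t‖ := by
      refine eventually_all.2 fun i => eventually_all.2 fun j => ?_
      by_cases hij : i = j
      · exact Eventually.of_forall fun _ h => absurd hij h
      · filter_upwards [eventually_forall_le_of_pos (f := fun t => ‖u i t - u j t‖) (by fun_prop)
          fun t => norm_pos_iff.2 (sub_ne_zero.2 fun h => hij (hu t h))] with ε h _ using h
    have h2 : ∀ᶠ ε in 𝓝[>] (0 : ℝ), ∀ i, ∀ t, ε ≤ R - ‖u i t‖ :=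
      eventually_all.2 fun i => eventually_forall_le_of_pos (by fun_prop)
        fun t => sub_pos.2 (hR i t)
    obtain ⟨ε, ⟨h1, h2⟩, hε⟩ := ((h1.and h2).and self_mem_nhdsWithin).exists
    exact ⟨ε, hε, fun t i j h => h1 i j h t, fun t i => h2 i t⟩
  have hcard : (0 : ℝ) < Fintype.card ι + 1 := by positivity
  obtain ⟨N, hN, hsmall⟩ : ∃ N : ℕ, 0 < N ∧ ∀ s t : I, dist s t ≤ 1 / N →
      ∑ i, ‖u i s - u i t‖ < ε := by
    have hc : Continuous fun t i => u i t := by fun_prop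
    obtain ⟨δ, hδ, hδu⟩ := Metric.uniformContinuous_iff.1
      (CompactSpace.uniformContinuous_of_continuous hc) (ε / (Fintype.card ι + 1))
      (div_pos hε hcard)
    obtain ⟨n, hn⟩ := exists_nat_one_div_lt hδ
    refine ⟨n + 1, n.succ_pos, fun s t hst => ?_⟩
    have h1 := hδu (lt_of_le_of_lt hst (by exact_mod_cast hn))
    have h2 : ∀ i, ‖u i s - u i t‖ ≤ ε / (Fintype.card ι + 1) := fun i => by
      rw [← dist_eq_norm]
      exact (dist_le_pi_dist (fun i => u i s) (fun i => u i t) i).trans h1.le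
    calc ∑ i, ‖u i s - u i t‖ ≤ ∑ _i : ι, ε / (Fintype.card ι + 1) :=
          Finset.sum_le_sum fun i _ => h2 i
      _ = Fintype.card ι * ε / (Fintype.card ι + 1) := by
          rw [Finset.sum_const, Finset.card_univ, nsmul_eq_mul, mul_div_assoc]
      _ < ε := by rw [div_lt_iff₀ hcard]; nlinarith
  have hN' : (0 : ℝ) < N := by exact_mod_cast hN
  -- Stage k of the induction undoes the motion up to time t * k / N. One `pushBack` passes to stage
  -- k + 1, and N is large enough to make it injective.
  let τ : ℕ → I → I := fun k t => t * Set.projIcc 0 1 zero_le_one ((k : ℝ) / N)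
  have hτc : ∀ k, Continuous (τ k) := fun k => continuous_id.mul continuous_const
  have hτval : ∀ k, k ≤ N → ∀ t, (τ k t : ℝ) = t * (k / N) := by
    intro k hk t
    have : (k : ℝ) / N ∈ Set.Icc (0 : ℝ) 1 :=
      ⟨by positivity, (div_le_one hN').2 (by exact_mod_cast hk)⟩
    simp only [τ]
    rw [Set.projIcc_of_mem _ this]
    rfl
  have hτ0 : ∀ k, τ k 0 = 0 := fun k => zero_mul _
  have hind : ∀ k ≤ N, ∃ γ : Isotopy, (∀ i t, γ.toFun t (u i (τ k t)) = u i 0) ∧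
      ∀ t z, R ≤ ‖z‖ → γ.toFun t z = z := by
    intro k
    induction k with
    | zero =>
      intro _
      refine ⟨⟨fun _ z => z, continuous_snd, fun _ => Function.injective_id, fun _ => rfl⟩,
        fun i t => ?_, fun _ _ _ => rfl⟩
      have : τ 0 t = 0 := Subtype.ext (by rw [hτval 0 (Nat.zero_le _)]; simp)
      simp [this]
    | succ k ih =>
      intro hk
      obtain ⟨γ, hγ, hγR⟩ := ih (by omega)
      let Ψ : I → ℂ → ℂ := fun t =>
        pushBack ε (fun i => u i (τ (k + 1) t)) (fun i => u i (τ (k + 1) t) - u i (τ k t))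
      have hΨc : Continuous fun p : I × ℂ => Ψ p.1 p.2 := by
        have h1 := hτc k
        have h2 := hτc (k + 1)
        simp only [Ψ, pushBack]
        fun_prop
      refine ⟨⟨fun t z => γ.toFun t (Ψ t z),
        γ.continuous_uncurry.comp (continuous_fst.prodMk hΨc), fun t => ?_, fun z => ?_⟩, ?_, ?_⟩
      · refine (γ.injective t).comp (pushBack_injective hε (hsmall _ _ ?_))
        rw [Subtype.dist_eq, Real.dist_eq, hτval _ hk, hτval k (by omega)]
        rw [show (t : ℝ) * (((k + 1 : ℕ) : ℝ) / N) - t * (k / N) = t * (1 / N) by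
          push_cast; ring]
        rw [abs_of_nonneg (mul_nonneg t.2.1 (by positivity))]
        exact mul_le_of_le_one_left (by positivity) t.2.2
      · rw [γ.map_zero]
        simp [Ψ, pushBack, hτ0]
      · intro i t
        have : Ψ t (u i (τ (k + 1) t)) = u i (τ k t) := by
          simp only [Ψ]
          rw [pushBack_center (c := fun i => u i (τ (k + 1) t)) hε
            (fun i j hij => hsep _ i j hij)]
          ring
        simp only [this]
        exact hγ i t
      · intro t z hz
        have : Ψ t z = z := pushBack_far hε fun i => by
          have h1 := hfar (τ (k + 1) t) i
          have h2 := norm_sub_norm_le z (u i (τ (k + 1) t))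
          linarith
        simp only [this]
        exact hγR t z hz
  obtain ⟨γ, hγ, hγR⟩ := hind N le_rfl
  refine ⟨γ, fun i t => ?_, hγR⟩
  have : τ N t = t := Subtype.ext (by rw [hτval N le_rfl, div_self hN'.ne', mul_one])
  have h := hγ i t
  rwa [this] at h

end PullBack

/-- Cross-multiplied form of the strict monotonicity of r ↦ r / (1 + q max(0, r - a)); for r ≥ a its
derivative has the sign of 1 - q a. -/
theorem shrink_radius_lt {a q r r' : ℝ} (hq : 0 ≤ q) (hqa : q * a < 1)
    (hr : r < r') :
    r * (1 + q * max 0 (r' - a)) < r' * (1 + q * max 0 (r - a)) := by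
  rcases le_total r a with h | h
  · rw [max_eq_left (sub_nonpos.2 h)]
    rcases le_total r' a with h' | h'
    · rw [max_eq_left (sub_nonpos.2 h')]; simpa using hr
    · rw [max_eq_right (sub_nonneg.2 h')]
      rcases h'.eq_or_lt with rfl | h''
      · simpa using hr
      have h1 : q * r ≤ q * a := mul_le_mul_of_nonneg_left h hq
      nlinarith [mul_le_mul_of_nonneg_right h1 (sub_nonneg.2 h'),
        mul_lt_mul_of_pos_right hqa (sub_pos.2 h'')]
  · rw [max_eq_right (sub_nonneg.2 h), max_eq_right (sub_nonneg.2 (h.trans hr.le))]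
    nlinarith [mul_pos (sub_pos.2 hr) (sub_pos.2 hqa)]

/-- The isotopy which at time `t` shrinks the plane towards the disk of radius `a`, fixing this
disk, with intensity `s t`; at full intensity the image has radius `b`. -/
theorem exists_isotopy_shrink {a b : ℝ} (ha : 0 ≤ a) (hab : a < b) (s : C(I, ℝ)) (hs0 : s 0 = 0)
    (hs : ∀ t, s t ∈ Set.Icc (0 : ℝ) 1) :
    ∃ γ : Isotopy, (∀ t z, ‖z‖ ≤ a → γ.toFun t z = z) ∧ (∀ t z, s t = 0 → γ.toFun t z = z) ∧
      ∀ t z, s t = 1 → ‖γ.toFun t z‖ < b := by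
  have hb : 0 < b := ha.trans_lt hab
  have hden : ∀ t (z : ℂ), 0 < 1 + s t / b * max 0 (‖z‖ - a) := fun t z => by
    have := (hs t).1
    positivity
  -- With s t = 1, a radius r ≥ a becomes r b / (b + r - a), which is below b because a < b.
  refine ⟨⟨fun t z => (1 + s t / b * max 0 (‖z‖ - a))⁻¹ • z, ?_, ?_, ?_⟩, ?_, ?_, ?_⟩
  · refine Continuous.smul (Continuous.inv₀ (by fun_prop) fun p => (hden p.1 p.2).ne')
      continuous_snd
  · intro t z w h
    have hq : 0 ≤ s t / b := div_nonneg (hs t).1 hb.le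
    have hqa : s t / b * a < 1 := by
      rw [div_mul_eq_mul_div, div_lt_one hb]
      have := (hs t).2
      nlinarith
    have hnorm : ‖z‖ * (1 + s t / b * max 0 (‖w‖ - a)) = ‖w‖ * (1 + s t / b * max 0 (‖z‖ - a)) := by
      have h1 := congrArg norm h
      simp only [norm_smul, norm_inv, Real.norm_eq_abs, abs_of_pos (hden _ _)] at h1
      have h2 := (hden t z).ne'
      have h3 := (hden t w).ne'
      rw [inv_mul_eq_iff_eq_mul₀ h2, mul_left_comm, eq_inv_mul_iff_mul_eq₀ h3] at h1
      linarith
    have heq : ‖z‖ = ‖w‖ := by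
      rcases lt_trichotomy ‖z‖ ‖w‖ with hlt | heq | hlt
      · exact absurd hnorm (shrink_radius_lt hq hqa hlt).ne
      · exact heq
      · exact absurd hnorm.symm (shrink_radius_lt hq hqa hlt).ne
    simp only [heq] at h
    exact smul_right_injective ℂ (inv_ne_zero (hden t w).ne') h
  · intro z; simp [hs0]
  · intro t z hz
    simp [max_eq_left (sub_nonpos.2 hz)]
  · intro t z ht
    simp [ht]
  · intro t z ht
    change ‖(1 + s t / b * max 0 (‖z‖ - a))⁻¹ • z‖ < b
    rw [norm_smul, norm_inv, Real.norm_eq_abs, abs_of_pos (hden t z),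
      inv_mul_lt_iff₀ (hden t z), ht]
    have h1 : (1 + 1 / b * max 0 (‖z‖ - a)) * b = b + max 0 (‖z‖ - a) := by
      field_simp
    rw [h1]
    linarith [le_max_right 0 (‖z‖ - a)]

/-- The isotopy rotating a disk by a half turn and reversing the order of the integer points
`0, 1, …, M` in it, while fixing the other natural numbers. -/
theorem exists_isotopy_reverse (M : ℕ) : ∃ γ : Isotopy,
    (∀ k : ℕ, k ≤ M → γ.toFun 1 k = ((M - k : ℕ) : ℂ)) ∧ ∀ k : ℕ, M < k → γ.toFun 1 k = k := by
  let c : ℂ := ((M / 2 : ℝ) : ℂ)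
  -- The cutoff is 1 within M/2 of the centre, where 0, …, M lie, and 0 beyond M/2 + 1, where the
  -- larger integers lie. It depends only on the distance to the centre, so each circle is rotated
  -- rigidly.
  let θ : ℂ → ℝ := fun z => max 0 (min 1 (M / 2 + 1 - ‖z - c‖))
  have hnorm : ∀ k : ℕ, ‖(k : ℂ) - c‖ = |(k : ℝ) - M / 2| := fun k => by
    rw [← Complex.ofReal_natCast, ← Complex.ofReal_sub, Complex.norm_real, Real.norm_eq_abs]
  let F : I → ℂ → ℂ := fun t z =>
    c + Complex.exp (((Real.pi * t * θ z : ℝ) : ℂ) * Complex.I) * (z - c)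
  have hF : ∀ t z, ‖F t z - c‖ = ‖z - c‖ := fun t z => by
    simp only [F]
    rw [add_sub_cancel_left, norm_mul, Complex.norm_exp_ofReal_mul_I, one_mul]
  refine ⟨⟨F, by simp only [F, θ]; fun_prop, ?_, fun z => by simp [F]⟩, ?_, ?_⟩
  · intro t z w h
    have h1 : ‖z - c‖ = ‖w - c‖ := by rw [← hF t z, ← hF t w, h]
    simp only [F, θ, h1] at h
    have h2 := mul_left_cancel₀ (Complex.exp_ne_zero _) (add_left_cancel h)
    exact sub_left_injective h2
  · intro k hk
    have hk' : (k : ℝ) ≤ M := by exact_mod_cast hk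
    have hθ : θ k = 1 := by
      simp only [θ]
      rw [hnorm, min_eq_left, max_eq_right zero_le_one]
      have : |(k : ℝ) - M / 2| ≤ M / 2 := abs_le.2 ⟨by linarith [k.cast_nonneg (α := ℝ)], by linarith⟩
      linarith
    simp only [F, hθ]
    rw [Nat.cast_sub hk]
    simp only [Set.Icc.coe_one, mul_one, Complex.exp_pi_mul_I]
    simp only [c]
    push_cast
    ring
  · intro k hk
    have hk' : (M : ℝ) + 1 ≤ k := by exact_mod_cast hk
    have hθ : θ k = 0 := by
      simp only [θ]
      rw [hnorm, max_eq_left]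
      refine (min_le_right _ _).trans ?_
      have := le_abs_self ((k : ℝ) - M / 2)
      linarith
    simp [F, hθ]

end InfBraid

/-! ### Bringing finitely many strings to rest -/

namespace InfBraid

open unitInterval

/-- The string starting at the natural number `k`. -/
def str (k : ℕ) : omega := ⟨k, k, rfl⟩

theorem exists_str_eq (x : omega) : ∃ k, str k = x := by
  obtain ⟨_, k, rfl⟩ := x
  exact ⟨k, rfl⟩

theorem str_injective : Function.Injective str := fun _ _ h =>
  Nat.cast_injective (congrArg Subtype.val h)

/-- Loops in `F_ω` based at the identity. -/
abbrev OmegaLoop : Type := Path (basePoint omega) (basePoint omega)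

/-- The string `k` does not move during `p`. -/
def Rests (k : ℕ) (p : OmegaLoop) : Prop := ∀ t, (p t).1 (str k) = k

theorem Rests.trans {k : ℕ} {p q : OmegaLoop} (hp : Rests k p) (hq : Rests k q) :
    Rests k (p.trans q) := by
  intro t
  rw [Path.trans_apply]
  split_ifs
  · exact hp _
  · exact hq _

theorem Rests.symm {k : ℕ} {p : OmegaLoop} (hp : Rests k p) : Rests k p.symm := fun _ => hp _

theorem rests_refl (k : ℕ) : Rests k (Path.refl _) := fun _ => rfl

/-- The classes of loops during which the strings `0, …, n` do not move. -/
def restingClasses (n : ℕ) : AddSubgroup OmegaBraidAb where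
  carrier := {a | ∃ p : OmegaLoop, (∀ k ≤ n, Rests k p) ∧ (Braid.ofLoop p).ab = a}
  zero_mem' := ⟨Path.refl _, fun k _ => rests_refl k, Braid.ab_ofLoop_refl⟩
  add_mem' := by
    rintro _ _ ⟨p, hp, rfl⟩ ⟨q, hq, rfl⟩
    exact ⟨p.trans q, fun k hk => (hp k hk).trans (hq k hk), Braid.ab_ofLoop_trans p q⟩
  neg_mem' := by
    rintro _ ⟨p, hp, rfl⟩
    exact ⟨p.symm, fun k hk => (hp k hk).symm, Braid.ab_ofLoop_symm p⟩

theorem ab_mem_restingClasses {n : ℕ} {f : Braid omega} (hperm : f.perm = 1)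
    (h : ∀ k ≤ n, ∀ t, (f.path t).1 (str k) = k) : f.ab ∈ restingClasses n := by
  obtain ⟨ρ, p⟩ := f
  obtain rfl : ρ = 1 := hperm
  exact ⟨p, h, rfl⟩

/-- The permutation of `ω` reversing the order of `0, …, M`. -/
noncomputable def reversePerm (M : ℕ) : Equiv.Perm omega :=
  (Equiv.ofBijective str ⟨str_injective, exists_str_eq⟩).permCongr
    (Function.Involutive.toPerm (fun k => if k ≤ M then M - k else k) fun k => by
      by_cases h : k ≤ M
      · simp only [h, if_true, Nat.sub_le]
        omega
      · simp only [h, if_false])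

theorem reversePerm_str (M k : ℕ) :
    reversePerm M (str k) = str (if k ≤ M then M - k else k) := by
  unfold reversePerm
  rw [Equiv.permCongr_apply,
    show str k = Equiv.ofBijective str ⟨str_injective, exists_str_eq⟩ k from rfl,
    Equiv.symm_apply_apply]
  rfl

theorem reversePerm_symm_str {M k : ℕ} (hk : k ≤ M) :
    (reversePerm M).symm (str k) = str (M - k) := by
  rw [Equiv.symm_apply_eq, reversePerm_str, if_pos (Nat.sub_le _ _), Nat.sub_sub_self hk]

/-- Up to commutators, a pure isotopy supported near `0, …, n` can be moved away from there. -/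
theorem toBraid_ab_mem_restingClasses (n : ℕ) (γ : Isotopy)
    (hγ : ∀ t, ∀ k : ℕ, n < k → γ.toFun t k = k)
    (hone : ∀ x : omega, γ.toFun 1 x = (1 : Equiv.Perm omega) x) :
    (γ.toBraid 1 hone).ab ∈ restingClasses n := by
  -- Reversing 0, …, 2n + 1 exchanges 0, …, n with n + 1, …, 2n + 1, which γ fixes.
  obtain ⟨r, hr, hr'⟩ := exists_isotopy_reverse (2 * n + 1)
  have hrρ : ∀ x : omega, r.toFun 1 x = reversePerm (2 * n + 1) x := by
    intro x
    obtain ⟨k, rfl⟩ := exists_str_eq x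
    rw [reversePerm_str]
    split_ifs with h
    · exact hr k h
    · exact hr' k (not_le.1 h)
  rw [← r.ab_conj _ (reversePerm (2 * n + 1)) hrρ]
  refine ab_mem_restingClasses ?_ fun k hk t => ?_
  · change reversePerm (2 * n + 1) * 1 * (reversePerm (2 * n + 1))⁻¹ = 1
    simp
  · change r.toFun 1 (γ.toFun t ((reversePerm (2 * n + 1)).symm (str k))) = k
    rw [reversePerm_symm_str (by omega)]
    change r.toFun 1 (γ.toFun t ((2 * n + 1 - k : ℕ) : ℂ)) = k
    rw [hγ t _ (by omega), hr _ (Nat.sub_le _ _), Nat.sub_sub_self (by omega)]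

theorem restingClasses_eq_top (n : ℕ) : restingClasses n = ⊤ := by
  rw [AddSubgroup.eq_top_iff']
  intro a
  obtain ⟨p, rfl⟩ := exists_ofLoop_eq a
  have hpc : ∀ k, Continuous fun t => (p t).1 (str k) := fun k =>
    (continuous_apply (str k)).comp (continuous_subtype_val.comp p.continuous)
  have hp0 : ∀ k, (p 0).1 (str k) = k := fun k => by rw [p.source]; rfl
  have hp1 : ∀ k, (p 1).1 (str k) = k := fun k => by rw [p.target]; rfl
  -- The shrinking is off at both ends. While s < 1 the strings up to n stay within n + 1/4 and are
  -- unaffected; where s = 1 the whole plane is pressed into radius n + 1/2.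
  let s : C(I, ℝ) :=
    ⟨fun t => min 1 (4 * ∑ k ∈ Finset.range (n + 1), ‖(p t).1 (str k) - k‖), by fun_prop⟩
  have hs0 : s 0 = 0 := by
    simp only [s, ContinuousMap.coe_mk, hp0]; simp
  have hs1 : s 1 = 0 := by
    simp only [s, ContinuousMap.coe_mk, hp1]; simp
  have hs : ∀ t, s t ∈ Set.Icc (0 : ℝ) 1 := fun t =>
    ⟨le_min zero_le_one (by positivity), min_le_left _ _⟩
  have hsmall : ∀ t, s t < 1 → ∀ k ≤ n, ‖(p t).1 (str k)‖ ≤ n + 1 / 4 := by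
    intro t ht k hk
    have h1 : 4 * ∑ k ∈ Finset.range (n + 1), ‖(p t).1 (str k) - k‖ < 1 := by
      rcases min_lt_iff.1 ht with h | h
      · exact absurd h (lt_irrefl _)
      · exact h
    have h2 := Finset.single_le_sum (f := fun k : ℕ => ‖(p t).1 (str k) - k‖)
      (fun _ _ => norm_nonneg _) (Finset.mem_range.2 (Nat.lt_succ_of_le hk))
    have h3 := norm_sub_norm_le ((p t).1 (str k)) k
    rw [Complex.norm_natCast] at h3
    have h4 : (k : ℝ) ≤ n := by exact_mod_cast hk
    linarith
  have hn : (0 : ℝ) ≤ n := n.cast_nonneg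
  obtain ⟨h, hfix, hzero, hball⟩ := exists_isotopy_shrink (a := n + 1 / 4) (b := n + 1 / 2)
    (by positivity) (by linarith) s hs0 hs
  have hone : ∀ x : omega, h.toFun 1 x = (1 : Equiv.Perm omega) x := fun x => hzero _ _ hs1
  have hrest : (h.toBraid 1 hone).ab ∈ restingClasses n :=
    ab_mem_restingClasses rfl fun k hk t => hfix t k (by
      rw [Complex.norm_natCast]
      have : (k : ℝ) ≤ n := by exact_mod_cast hk
      linarith)
  set q := h.apply (Braid.ofLoop p) 1 hone with hq
  have hqab := h.ab_apply (Braid.ofLoop p) 1 hone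
  rw [← hq] at hqab
  have hqperm : q.perm = 1 := rfl
  have hqb : ∀ k ≤ n, ∀ t, ‖(q.path t).1 (str k)‖ < n + 1 / 2 := by
    intro k hk t
    change ‖h.toFun t ((p t).1 (str k))‖ < _
    rcases (hs t).2.lt_or_eq with hlt | heq
    · rw [hfix t _ (hsmall t hlt k hk)]
      linarith [hsmall t hlt k hk]
    · exact hball t _ heq
  have hqc : ∀ k, Continuous fun t => (q.path t).1 (str k) := fun k =>
    (continuous_apply (str k)).comp (continuous_subtype_val.comp q.path.continuous)
  -- The strings up to n now stay within n + 1/2, so γ can undo their motion while fixing n + 1, n +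
  -- 2, ….
  obtain ⟨γ, hγ, hγR⟩ := exists_isotopy_pullback
    (fun k : Fin (n + 1) => (⟨fun t => (q.path t).1 (str k), hqc k⟩ : C(I, ℂ)))
    (fun t k l hkl => Fin.ext (str_injective ((q.path t).2 hkl))) (n + 1 / 2)
    (fun k t => hqb k (Nat.lt_succ_iff.1 k.2) t)
  have hγq : ∀ k ≤ n, ∀ t, γ.toFun t ((q.path t).1 (str k)) = k := fun k hk t =>
    (hγ ⟨k, Nat.lt_succ_of_le hk⟩ t).trans (q.path_zero _)
  have hγfar : ∀ t, ∀ k : ℕ, n < k → γ.toFun t k = k := fun t k hk => hγR t k (by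
    rw [Complex.norm_natCast]
    have : (n : ℝ) + 1 ≤ k := by exact_mod_cast hk
    linarith)
  have hγone : ∀ x : omega, γ.toFun 1 x = (1 : Equiv.Perm omega) x := by
    intro x
    obtain ⟨k, rfl⟩ := exists_str_eq x
    rcases le_or_gt k n with hk | hk
    · have h1 := hγq k hk 1
      rw [q.path_one, hqperm] at h1
      exact h1
    · exact hγfar 1 k hk
  have h1 := toBraid_ab_mem_restingClasses n γ hγfar hγone
  have h2 : (γ.apply q 1 hγone).ab ∈ restingClasses n :=
    ab_mem_restingClasses rfl hγq
  rw [γ.ab_apply] at h2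
  have h3 : q.ab ∈ restingClasses n := (add_mem_cancel_right h1).1 h2
  rw [hqab] at h3
  exact (add_mem_cancel_right hrest).1 h3

/-! ### Infinite nested products of loops -/

/-- The strings `k` of `p` and `q` move in the same way. -/
def Agree (k : ℕ) (p q : OmegaLoop) : Prop := ∀ t, (p t).1 (str k) = (q t).1 (str k)

theorem Agree.trans_congr {k : ℕ} {p p' q q' : OmegaLoop} (hp : Agree k p p')
    (hq : Agree k q q') : Agree k (p.trans q) (p'.trans q') := by
  intro t
  rw [Path.trans_apply, Path.trans_apply]
  split_ifs
  · exact hp _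
  · exact hq _

/-- The `j`-fold concatenation of `p`. -/
noncomputable def loopPow (p : OmegaLoop) : ℕ → OmegaLoop
  | 0 => Path.refl _
  | j + 1 => p.trans (loopPow p j)

theorem ab_loopPow (p : OmegaLoop) (j : ℕ) :
    (Braid.ofLoop (loopPow p j)).ab = j • (Braid.ofLoop p).ab := by
  induction j with
  | zero => rw [zero_smul]; exact Braid.ab_ofLoop_refl
  | succ j ih => rw [loopPow, Braid.ab_ofLoop_trans, ih, succ_nsmul']

theorem Agree.loopPow_congr {k : ℕ} {p p' : OmegaLoop} (hp : Agree k p p') (j : ℕ) :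
    Agree k (loopPow p j) (loopPow p' j) := by
  induction j with
  | zero => exact fun _ => rfl
  | succ j ih => exact hp.trans_congr ih

theorem Rests.loopPow {k : ℕ} {p : OmegaLoop} (hp : Rests k p) (j : ℕ) :
    Rests k (loopPow p j) := by
  induction j with
  | zero => exact rests_refl k
  | succ j ih => exact hp.trans ih

/-- The product `b n · (b (n + 1) · (⋯)^(e (n + 1)))^(e n)` of depth `d`. -/
noncomputable def nestedProduct (b : ℕ → OmegaLoop) (e : ℕ → ℕ) : ℕ → ℕ → OmegaLoop
  | 0, _ => Path.refl _
  | d + 1, n => (b n).trans (loopPow (nestedProduct b e d (n + 1)) (e n))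

theorem nestedProduct_rests {b : ℕ → OmegaLoop} (hb : ∀ n, ∀ k < n, Rests k (b n)) (e : ℕ → ℕ)
    (d : ℕ) : ∀ {n k : ℕ}, k < n → Rests k (nestedProduct b e d n) := by
  induction d with
  | zero => exact fun _ => rests_refl _
  | succ d ih => exact fun h => (hb _ _ h).trans ((ih (by omega)).loopPow _)

/-- Passing from depth d to d + 1 only inserts copies of b (n + d), which move no string below n +
d. -/
theorem nestedProduct_agree_succ {b : ℕ → OmegaLoop} (hb : ∀ n, ∀ k < n, Rests k (b n)) (e : ℕ → ℕ)
    (d : ℕ) : ∀ {n k : ℕ}, k < n + d →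
    Agree k (nestedProduct b e d n) (nestedProduct b e (d + 1) n) := by
  induction d with
  | zero =>
    intro n k h t
    rw [nestedProduct_rests hb e 0 (by omega) t, nestedProduct_rests hb e 1 (by omega) t]
  | succ d ih =>
    intro n k h
    exact Agree.trans_congr (fun _ => rfl) ((ih (by omega)).loopPow_congr _)

theorem nestedProduct_agree {b : ℕ → OmegaLoop} (hb : ∀ n, ∀ k < n, Rests k (b n)) (e : ℕ → ℕ)
    {d n k : ℕ} (h : k < d) :
    Agree k (nestedProduct b e d n) (nestedProduct b e (k + 1) n) := by
  induction d, h using Nat.le_induction with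
  | base => exact fun _ => rfl
  | succ d hd ih =>
    intro t
    rw [← ih t]
    exact (nestedProduct_agree_succ hb e d (by omega) t).symm

/-- The infinite nested product converges if the strings `k < n` do not move during `b n`. -/
theorem exists_infinite_product {b : ℕ → OmegaLoop} (hb : ∀ n, ∀ k < n, Rests k (b n)) (e : ℕ → ℕ) :
    ∃ c : ℕ → OmegaLoop,
    ∀ n, c n = (b n).trans (loopPow (c (n + 1)) (e n)) := by
  choose idx hidx using exists_str_eq
  have hidx' : ∀ k, idx (str k) = k := fun k => str_injective (hidx _)
  have hinj : ∀ n t, Function.Injective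
      fun x : omega => (nestedProduct b e (idx x + 1) n t).1 x := by
    intro n t x y hxy
    have hx := nestedProduct_agree hb e (n := n)
      (show idx x < max (idx x) (idx y) + 1 by omega) t
    have hy := nestedProduct_agree hb e (n := n)
      (show idx y < max (idx x) (idx y) + 1 by omega) t
    rw [hidx] at hx hy
    exact (nestedProduct b e (max (idx x) (idx y) + 1) n t).2 (hx.trans (hxy.trans hy.symm))
  -- Each string is read off at a depth where it has stabilized. Continuity is coordinatewise;
  -- injectivity compares two strings at a common depth.
  let c : ℕ → OmegaLoop := fun n =>
    { toFun := fun t => ⟨fun x => (nestedProduct b e (idx x + 1) n t).1 x, hinj n t⟩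
      continuous_toFun := Continuous.subtype_mk (continuous_pi fun x =>
        (continuous_apply x).comp (continuous_subtype_val.comp
          (nestedProduct b e (idx x + 1) n).continuous)) (hinj n)
      source' := Subtype.ext (funext fun x => by
        change (nestedProduct b e (idx x + 1) n 0).1 x = _
        rw [Path.source])
      target' := Subtype.ext (funext fun x => by
        change (nestedProduct b e (idx x + 1) n 1).1 x = _
        rw [Path.target]) }
  have hc : ∀ n k, Agree k (c n) (nestedProduct b e (k + 1) n) := by
    intro n k t
    change (nestedProduct b e (idx (str k) + 1) n t).1 (str k) = _
    rw [hidx']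
  refine ⟨c, fun n => Path.ext (funext fun t => Subtype.ext (funext fun x => ?_))⟩
  obtain ⟨k, rfl⟩ := exists_str_eq x
  -- Depth k + 2 is used so that removing the outer factor leaves depth k + 1. The recursion is an
  -- equality of paths, not merely a homotopy.
  have h1 : (c n t).1 (str k) = (nestedProduct b e (k + 1 + 1) n t).1 (str k) := by
    rw [hc n k t, nestedProduct_agree hb e (show k < k + 1 + 1 by omega) t]
  rw [h1]
  exact Agree.trans_congr (fun _ => rfl)
    (Agree.loopPow_congr (fun s => (hc (n + 1) k s).symm) (e n)) t

theorem solvesRecursions_omegaBraidAb : SolvesRecursions OmegaBraidAb := by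
  intro a e
  have hex : ∀ n, a n ∈ restingClasses n := fun n => by
    rw [restingClasses_eq_top]; exact AddSubgroup.mem_top _
  choose b hb hab using hex
  obtain ⟨c, hc⟩ := exists_infinite_product (fun n k hk => hb n k hk.le) e
  refine ⟨fun n => (Braid.ofLoop (c n)).ab, fun n => ?_⟩
  change (Braid.ofLoop (c n)).ab = a n + e n • (Braid.ofLoop (c (n + 1))).ab
  rw [hc n]
  rw [Braid.ab_ofLoop_trans, ab_loopPow, hab]

end InfBraid

theorem theorem2p8 :
    InfBraid.IsCotorsion InfBraid.OmegaBraidAb ∧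
      InfBraid.IsCompleteModUlm InfBraid.OmegaBraidAb :=
  ⟨InfBraid.solvesRecursions_omegaBraidAb.isCotorsion,
    InfBraid.solvesRecursions_omegaBraidAb.isCompleteModUlm⟩
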